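/- **Theorem.** Let $n \ge 2$, let $S^{n-1} \subset \mathbb{R}^n$ be the unit sphere with surface measure $\omega$, and equip the space $\mathcal{C}(S^{n-1})$ of complex-valued continuous functions with the inner product $(f,g) = \int_{S^{n-1}} f(x)\overline{g(x)}\,d\omega(x)$ and with the action $(uf)(x) = f(u^{-1}x)$ of the orthogonal group $\mathrm{O}(\mathbb{R}^n)$. Let $\mathrm{Pol}_{\le d}(S^{n-1})$ be the space of restrictions to $S^{n-1}$ of complex polynomials in $n$ variables of degree at most $d$, and let $H_k$ be the space of restrictions to $S^{n-1}$ of complex polynomials that are homogeneous of degree $k$ (or zero) and are annihilated by $\Delta = \partial^2/\partial x_1^2 + \cdots + \partial^2/\partial x_n^2$. Each $H_k$ is $\mathrm{O}(\mathbb{R}^n)$-invariant, and: 1. For every $d \ge 0$, the space $\mathrm{Pol}_{\le d}(S^{n-1})$ is the orthogonal direct sum $$\mathrm{Pol}_{\le d}(S^{n-1}) = H_0 \perp H_1 \perp \cdots \perp H_d.$$ 2. For every $k \ge 0$ and every $e \in S^{n-1}$, the zonal spherical functions with pole $e$ that lie in $H_k$, i.e. the $f \in H_k$ with $uf = f$ for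 all $u \in \mathrm{O}(\mathbb{R}^n)$ with $ue = e$, form a space of dimension exactly one. 3. Every $H_k$, $k \ge 0$, is $\mathrm{O}(\mathbb{R}^n)$-irreducible: it is nonzero and its only $\mathrm{O}(\mathbb{R}^n)$-invariant subspaces are $\{0\}$ and $H_k$. 4. For $j \ne k$, the spaces $H_j$ and $H_k$ are inequivalent: there is no bijective linear map $T : H_j \to H_k$ with $T(uf) = uT(f)$ for all $u \in \mathrm{O}(\mathbb{R}^n)$ and $f \in H_j$. -/

import Mathlib

open MeasureTheory

noncomputable section

namespace SphericalHarmonics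

/-- The Euclidean space `ℝⁿ`. -/
abbrev Euc (n : ℕ) : Type := EuclideanSpace ℝ (Fin n)

/-- The unit sphere `Sⁿ⁻¹` in `ℝⁿ`. -/
abbrev Sph (n : ℕ) : Type := Metric.sphere (0 : Euc n) 1

/-- The orthogonal group `O(ℝⁿ)`: the linear isometries of `ℝⁿ` onto itself. -/
abbrev Orth (n : ℕ) : Type := Euc n ≃ₗᵢ[ℝ] Euc n

/-- The surface measure on the sphere induced by Lebesgue measure on `ℝⁿ`. -/
def surface (n : ℕ) : Measure (Sph n) := (volume : Measure (Euc n)).toSphere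

/-- The inner product `(f, g) = ∫ f(x) conj(g(x)) dω(x)` on `C(Sⁿ⁻¹)`. -/
def sphInner {n : ℕ} (f g : C(Sph n, ℂ)) : ℂ :=
  ∫ x, f x * (starRingEnd ℂ) (g x) ∂(surface n)

/-- The self-map `x ↦ u x` of the sphere given by an orthogonal transformation `u`. -/
def sphMap {n : ℕ} (u : Orth n) : C(Sph n, Sph n) where
  toFun x := ⟨u (x : Euc n), by simp⟩
  continuous_toFun := by fun_prop

/-- The action `(u f)(x) = f(u⁻¹ x)` of the orthogonal group on `C(Sⁿ⁻¹)`. -/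
def sphRep (n : ℕ) : Representation ℂ (Orth n) C(Sph n, ℂ) where
  toFun u :=
    { toFun := fun f => f.comp (sphMap u⁻¹)
      map_add' := fun _ _ => rfl
      map_smul' := fun _ _ => rfl }
  map_one' := rfl
  map_mul' u v := by
    ext f x
    simp only [LinearMap.coe_mk, AddHom.coe_mk, Module.End.mul_apply, mul_inv_rev]
    rfl

/-- Restriction of a complex polynomial in `n` variables to a function on `Sⁿ⁻¹`. -/
def restr (n : ℕ) : MvPolynomial (Fin n) ℂ →ₗ[ℂ] C(Sph n, ℂ) where
  toFun p :=
    { toFun := fun x => MvPolynomial.eval (fun i => (((x : Euc n) i : ℝ) : ℂ)) p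
      continuous_toFun := by
        refine (MvPolynomial.continuous_eval p).comp ?_
        fun_prop }
  map_add' p q := by ext x; simp
  map_smul' c p := by ext x; simp

/-- `Pol_{≤ d}(Sⁿ⁻¹)`: the restrictions to the sphere of the polynomials of degree at most `d`. -/
def polSph (n d : ℕ) : Submodule ℂ C(Sph n, ℂ) :=
  (MvPolynomial.restrictTotalDegree (Fin n) ℂ d).map (restr n)

/-- The Laplace operator `Δ = ∂²/∂x₁² + ⋯ + ∂²/∂xₙ²` on polynomials. -/
def lap (n : ℕ) : MvPolynomial (Fin n) ℂ →ₗ[ℂ] MvPolynomial (Fin n) ℂ :=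
  ∑ i, (MvPolynomial.pderiv i).toLinearMap ∘ₗ (MvPolynomial.pderiv i).toLinearMap

/-- `Harm_k`: the homogeneous polynomials of degree `k` (and zero) killed by the Laplace
operator. -/
def harm (n k : ℕ) : Submodule ℂ (MvPolynomial (Fin n) ℂ) :=
  MvPolynomial.homogeneousSubmodule (Fin n) ℂ k ⊓ LinearMap.ker (lap n)

/-- The `i`-th coordinate of `u⁻¹ x`, as a linear form in `x`: its coefficients are the
coordinates of `u eᵢ`. -/
def linForm {n : ℕ} (u : Orth n) (i : Fin n) : MvPolynomial (Fin n) ℂ :=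
  ∑ j, MvPolynomial.C ((u (EuclideanSpace.single i 1) j : ℝ) : ℂ) * MvPolynomial.X j

/-- The substitution `p(x) ↦ p(u⁻¹ x)` on polynomials. -/
def polSubst {n : ℕ} (u : Orth n) : MvPolynomial (Fin n) ℂ →ₐ[ℂ] MvPolynomial (Fin n) ℂ :=
  MvPolynomial.aeval (linForm u)

theorem restr_polSubst {n : ℕ} (u : Orth n) (p : MvPolynomial (Fin n) ℂ) :
    restr n (polSubst u p) = sphRep n u (restr n p) := by
  ext x
  have key : ∀ i, MvPolynomial.eval (fun i => (((x : Euc n) i : ℝ) : ℂ)) (linForm u i)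
      = (((u⁻¹ (x : Euc n)) i : ℝ) : ℂ) := by
    intro i
    have h : (u⁻¹ (x : Euc n)) i = ∑ j, u (EuclideanSpace.single i 1) j * (x : Euc n) j := by
      have h1 : inner ℝ (EuclideanSpace.single i (1 : ℝ)) (u⁻¹ (x : Euc n))
          = inner ℝ (u (EuclideanSpace.single i (1 : ℝ))) (x : Euc n) := by
        rw [← u.inner_map_map (EuclideanSpace.single i 1) (u⁻¹ (x : Euc n))]
        congr 1
        exact u.apply_symm_apply _
      rw [EuclideanSpace.inner_single_left] at h1
      simp only [map_one, one_mul] at h1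
      rw [h1, PiLp.inner_apply]
      exact Finset.sum_congr rfl fun j _ => by simp [mul_comm]
    rw [h]
    simp [linForm]
  change MvPolynomial.eval _ (MvPolynomial.aeval (linForm u) p)
    = MvPolynomial.eval (fun i => (((u⁻¹ (x : Euc n)) i : ℝ) : ℂ)) p
  simp only [← key]
  induction p using MvPolynomial.induction_on with
  | C a => simp
  | add p q hp hq => simp only [map_add, hp, hq]
  | mul_X p i hp => simp only [map_mul, hp, MvPolynomial.aeval_X, MvPolynomial.eval_X]

theorem pderiv_polSubst {n : ℕ} (u : Orth n) (j : Fin n) (p : MvPolynomial (Fin n) ℂ) :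
    MvPolynomial.pderiv j (polSubst u p) =
      ∑ i, MvPolynomial.C ((u (EuclideanSpace.single i 1) j : ℝ) : ℂ) *
        polSubst u (MvPolynomial.pderiv i p) := by
  have hX : ∀ i, MvPolynomial.pderiv j (linForm u i)
      = MvPolynomial.C ((u (EuclideanSpace.single i 1) j : ℝ) : ℂ) := by
    intro i
    simp [linForm, MvPolynomial.pderiv_X, Pi.single_apply]
  induction p using MvPolynomial.induction_on with
  | C a => simp [polSubst]
  | add p q hp hq => simp only [map_add, hp, hq, mul_add, Finset.sum_add_distrib]
  | mul_X p k hp =>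
    have hk : polSubst u (MvPolynomial.X k) = linForm u k := by simp [polSubst]
    rw [map_mul, MvPolynomial.pderiv_mul, hp, hk, hX]
    simp only [MvPolynomial.pderiv_mul, map_add, map_mul, hk, mul_add, Finset.sum_add_distrib]
    congr 1
    · rw [Finset.sum_mul]
      exact Finset.sum_congr rfl fun i _ => by ring
    · rw [Finset.sum_eq_single k]
      · simp [mul_comm]
      · intro i _ hi
        rw [MvPolynomial.pderiv_X_of_ne (Ne.symm hi)]
        simp
      · simp

theorem lap_polSubst {n : ℕ} (u : Orth n) (p : MvPolynomial (Fin n) ℂ) :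
    lap n (polSubst u p) = polSubst u (lap n p) := by
  have orth : ∀ i k, ∑ j, (u (EuclideanSpace.single i 1) j : ℝ) * u (EuclideanSpace.single k 1) j
      = if i = k then 1 else 0 := by
    intro i k
    have h1 := u.inner_map_map (EuclideanSpace.single i (1 : ℝ)) (EuclideanSpace.single k 1)
    rw [EuclideanSpace.inner_single_left, PiLp.inner_apply] at h1
    simp only [map_one, one_mul, PiLp.single_apply] at h1
    rw [← h1]
    exact Finset.sum_congr rfl fun j _ => by simp [mul_comm]
  have hC : ∀ i k, ∑ j, (MvPolynomial.C ((u (EuclideanSpace.single i 1) j : ℝ) : ℂ) *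
      MvPolynomial.C ((u (EuclideanSpace.single k 1) j : ℝ) : ℂ) : MvPolynomial (Fin n) ℂ)
      = if i = k then 1 else 0 := by
    intro i k
    simp only [← map_mul, ← map_sum, ← Complex.ofReal_mul, ← Complex.ofReal_sum, orth]
    split_ifs <;> simp
  simp only [lap, LinearMap.sum_apply, LinearMap.comp_apply, Derivation.coeFn_coe,
    map_sum, pderiv_polSubst, MvPolynomial.pderiv_C_mul, Finset.mul_sum]
  rw [Finset.sum_comm]
  refine Finset.sum_congr rfl fun i _ => ?_
  rw [Finset.sum_comm]
  simp only [← mul_assoc, ← Finset.sum_mul, hC]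
  simp

theorem polSubst_mem_harm {n k : ℕ} (u : Orth n) {p : MvPolynomial (Fin n) ℂ}
    (hp : p ∈ harm n k) : polSubst u p ∈ harm n k := by
  obtain ⟨h1, h2⟩ := hp
  refine ⟨?_, ?_⟩
  · have h3 := MvPolynomial.IsHomogeneous.aeval (n := 1) h1 (linForm u) (fun i =>
      MvPolynomial.IsHomogeneous.sum _ _ _ fun j _ =>
        MvPolynomial.isHomogeneous_C_mul_X _ j)
    rw [one_mul] at h3
    exact h3
  · have h4 : lap n p = 0 := h2
    change lap n (polSubst u p) = 0
    rw [lap_polSubst, h4, map_zero]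

/-- The space `H_k` of spherical harmonics of degree `k`: the restrictions to `Sⁿ⁻¹` of the
harmonic homogeneous polynomials of degree `k`, as a subrepresentation of `C(Sⁿ⁻¹)`. -/
def sphHarm (n k : ℕ) : Subrepresentation (sphRep n) where
  toSubmodule := (harm n k).map (restr n)
  apply_mem_toSubmodule := by
    rintro u _ ⟨p, hp, rfl⟩
    exact ⟨polSubst u p, polSubst_mem_harm u hp, restr_polSubst u p⟩

/-- The space of continuous zonal spherical functions with pole `e`: those fixed by the
stabilizer of `e` in the orthogonal group. -/
def zonal {n : ℕ} (e : Sph n) : Submodule ℂ C(Sph n, ℂ) where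
  carrier := {f | ∀ u : Orth n, u (e : Euc n) = e → sphRep n u f = f}
  add_mem' := by
    intro f g hf hg u hu
    rw [map_add, hf u hu, hg u hu]
  zero_mem' := fun u _ => map_zero (sphRep n u)
  smul_mem' := by
    intro c f hf u hu
    rw [map_smul, hf u hu]

end SphericalHarmonics

end

noncomputable section

namespace SphericalHarmonics

open MvPolynomial
open scoped Pointwise

variable {n : ℕ}

/-! Write r² = x₁² + ⋯ + xₙ². Since Δ(r²ᵐ⁺² h) is a positive multiple of r²ᵐ h for harmonic
homogeneous h, every homogeneous polynomial is a sum of products r²ᵐ h (`mem_harmonicProducts`). On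
the sphere r² = 1, so the H_k with k ≤ d span the polynomials of degree at most d. Orthogonality is
an eigenvalue argument: the infinitesimal rotations are skew for the integral, and the sum of their
squares acts on harmonic polynomials of degree k by a scalar that determines k
(`sum_angular_angular`, `integralSph_mul_eq_zero`).

The rest rests on zonal functions. The reproducing kernel at e of a nonzero finite-dimensional
invariant space is zonal and nonzero at e (`exists_zonal`), so each H_k has at least one. Zonal
functions of degree at most d are polynomials of degree at most d in ⟨e, x⟩ (`zonal_inf_polSph_le`),
so there is no room for a second one in any H_k. A proper nonzero invariant subspace of H_k and its
complement would both need a zonal function. An equivalence H_j ≅ H_k would give an invariant space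
in H_j + H_k whose zonal functions all vanish at e. -/

/-! ### Harmonic decomposition of homogeneous polynomials -/

theorem lap_apply (p : MvPolynomial (Fin n) ℂ) :
    lap n p = ∑ i, pderiv i (pderiv i p) := by
  simp [lap]

/-- The polynomial `x₁² + ⋯ + xₙ²`. -/
def normSqPoly (n : ℕ) : MvPolynomial (Fin n) ℂ := ∑ i, X i ^ 2

theorem isHomogeneous_normSqPoly (n : ℕ) : (normSqPoly n).IsHomogeneous 2 :=
  IsHomogeneous.sum _ _ _ fun i _ => by simpa using (isHomogeneous_X ℂ i).pow 2

theorem pderiv_normSqPoly (j : Fin n) : pderiv j (normSqPoly n) = 2 * X j := by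
  simp only [normSqPoly, map_sum, Derivation.leibniz_pow, pderiv_X]
  rw [Finset.sum_eq_single j]
  · simp
  · intro i _ hi
    simp [hi]
  · simp

theorem lap_normSqPoly_mul {d : ℕ} {q : MvPolynomial (Fin n) ℂ} (hq : q.IsHomogeneous d) :
    lap n (normSqPoly n * q) = normSqPoly n * lap n q + (2 * n + 4 * d : ℕ) • q := by
  have h : ∀ i, pderiv i (pderiv i (normSqPoly n * q)) =
      2 * q + 4 * (X i * pderiv i q) + normSqPoly n * pderiv i (pderiv i q) := by
    intro i
    have h2 : pderiv i (2 : MvPolynomial (Fin n) ℂ) = 0 := by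
      rw [← map_ofNat C 2]; exact pderiv_C
    simp only [pderiv_mul, map_add, pderiv_normSqPoly, pderiv_X_self, h2]
    ring
  simp only [lap_apply, h, Finset.sum_add_distrib, ← Finset.mul_sum, hq.sum_X_mul_pderiv]
  simp only [Finset.sum_const, Finset.card_univ, Fintype.card_fin, nsmul_eq_mul]
  push_cast
  ring

theorem isHomogeneous_lap {d : ℕ} {q : MvPolynomial (Fin n) ℂ} (hq : q.IsHomogeneous d) :
    (lap n q).IsHomogeneous (d - 2) := by
  rw [lap_apply]
  exact IsHomogeneous.sum _ _ _ fun i _ => by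
    simpa [Nat.sub_sub] using hq.pderiv.pderiv

theorem isHomogeneous_normSqPoly_pow_mul {j m : ℕ} {h : MvPolynomial (Fin n) ℂ}
    (hh : h ∈ harm n j) : (normSqPoly n ^ m * h).IsHomogeneous (2 * m + j) :=
  ((isHomogeneous_normSqPoly n).pow m).mul hh.1

/-- Each further factor r² adds a nonnegative amount to the positive constant 2n + 4j. Only
positivity is recorded, because the constant is only ever divided by. -/
theorem exists_lap_normSqPoly_pow_mul (hn : 0 < n) {j : ℕ} {h : MvPolynomial (Fin n) ℂ}
    (hh : h ∈ harm n j) (m : ℕ) :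
    ∃ c : ℕ, 0 < c ∧ lap n (normSqPoly n ^ (m + 1) * h) = c • (normSqPoly n ^ m * h) := by
  induction m with
  | zero =>
    refine ⟨2 * n + 4 * j, by omega, ?_⟩
    have h0 : lap n h = 0 := hh.2
    simp [lap_normSqPoly_mul hh.1, h0]
  | succ m ih =>
    obtain ⟨c, -, hc⟩ := ih
    refine ⟨c + (2 * n + 4 * (2 * (m + 1) + j)), by omega, ?_⟩
    rw [pow_succ', mul_assoc, lap_normSqPoly_mul (isHomogeneous_normSqPoly_pow_mul hh), hc]
    rw [add_smul, pow_succ' _ m]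
    simp only [nsmul_eq_mul, Nat.cast_add]
    ring

/-- The span of the products of a power of `x₁² + ⋯ + xₙ²` with a harmonic polynomial, of total
degree `k`. -/
def harmonicProducts (n k : ℕ) : Submodule ℂ (MvPolynomial (Fin n) ℂ) :=
  Submodule.span ℂ {q | ∃ m j, 2 * m + j = k ∧ ∃ h ∈ harm n j, q = normSqPoly n ^ m * h}

theorem harmonicProducts_le (n k : ℕ) :
    harmonicProducts n k ≤ homogeneousSubmodule (Fin n) ℂ k := by
  refine Submodule.span_le.2 ?_
  rintro _ ⟨m, j, rfl, h, hh, rfl⟩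
  exact isHomogeneous_normSqPoly_pow_mul hh

theorem harm_le_harmonicProducts (n k : ℕ) : harm n k ≤ harmonicProducts n k := fun h hh =>
  Submodule.subset_span ⟨0, k, by simp, h, hh, by simp⟩

theorem exists_lap_eq (hn : 0 < n) {k : ℕ} {q : MvPolynomial (Fin n) ℂ}
    (hq : q ∈ harmonicProducts n k) : ∃ p ∈ harmonicProducts n (k + 2), lap n p = q := by
  have : harmonicProducts n k ≤ (harmonicProducts n (k + 2)).map (lap n) := by
    refine Submodule.span_le.2 ?_
    rintro _ ⟨m, j, rfl, h, hh, rfl⟩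
    obtain ⟨c, hc, he⟩ := exists_lap_normSqPoly_pow_mul hn hh m
    refine ⟨(c : ℂ)⁻¹ • (normSqPoly n ^ (m + 1) * h), Submodule.smul_mem _ _
      (Submodule.subset_span ⟨m + 1, j, by ring, h, hh, rfl⟩), ?_⟩
    rw [map_smul, he, ← Nat.cast_smul_eq_nsmul ℂ, smul_smul, inv_mul_cancel₀, one_smul]
    exact_mod_cast hc.ne'
  exact this hq

/-- By induction Δp is a combination of products, hence equals Δq for a combination q of products of
the degree of p; then p - q is harmonic. -/
theorem mem_harmonicProducts (hn : 0 < n) (k : ℕ) : ∀ {p : MvPolynomial (Fin n) ℂ},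
    p.IsHomogeneous k → p ∈ harmonicProducts n k := by
  induction k using Nat.strong_induction_on with
  | _ k ih =>
    intro p hp
    obtain hk | ⟨l, rfl⟩ : k < 2 ∨ ∃ l, k = l + 2 := by
      by_cases h : k < 2
      · exact Or.inl h
      · exact Or.inr ⟨k - 2, by omega⟩
    -- In degree below 2 the first derivatives are constant, so p is itself harmonic.
    · refine harm_le_harmonicProducts n k ⟨hp, ?_⟩
      change lap n p = 0
      rw [lap_apply]
      refine Finset.sum_eq_zero fun i _ => ?_
      have h0 : (pderiv i p).IsHomogeneous 0 := by
        have := hp.pderiv (i := i)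
        rwa [show k - 1 = 0 by omega] at this
      rw [← totalDegree_zero_iff_isHomogeneous, totalDegree_eq_zero_iff_eq_C] at h0
      rw [h0]
      exact pderiv_C
    · obtain ⟨q, hq, hqp⟩ := exists_lap_eq hn (ih l (by omega) (isHomogeneous_lap hp))
      have : p - q ∈ harm n (l + 2) :=
        ⟨Submodule.sub_mem _ hp (harmonicProducts_le _ _ hq), by simp [hqp]⟩
      simpa using Submodule.add_mem _ (harm_le_harmonicProducts _ _ this) hq

/-! ### Restriction to the sphere -/

theorem restr_apply (p : MvPolynomial (Fin n) ℂ) (x : Sph n) :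
    restr n p x = eval (fun i => (((x : Euc n) i : ℝ) : ℂ)) p := rfl

theorem restr_mul (p q : MvPolynomial (Fin n) ℂ) :
    restr n (p * q) = restr n p * restr n q := by
  ext x; simp [restr_apply]

theorem sum_sq_eq_one (x : Sph n) : ∑ i, (x : Euc n) i ^ 2 = 1 := by
  have := EuclideanSpace.real_norm_sq_eq (x : Euc n)
  rw [norm_eq_of_mem_sphere] at this
  simpa using this.symm

theorem restr_normSqPoly (n : ℕ) : restr n (normSqPoly n) = 1 := by
  ext x
  rw [restr_apply, normSqPoly, map_sum]
  simp only [map_pow, eval_X, ContinuousMap.one_apply]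
  exact_mod_cast sum_sq_eq_one x

theorem restr_normSqPoly_pow_mul (m : ℕ) (p : MvPolynomial (Fin n) ℂ) :
    restr n (normSqPoly n ^ m * p) = restr n p := by
  induction m with
  | zero => simp
  | succ m ih => rw [pow_succ', mul_assoc, restr_mul, ih, restr_normSqPoly, one_mul]

theorem sphHarm_le_polSph {k d : ℕ} (hk : k ≤ d) : (sphHarm n k).toSubmodule ≤ polSph n d := by
  refine Submodule.map_mono fun p hp => ?_
  rw [mem_restrictTotalDegree]
  exact hp.1.totalDegree_le.trans hk

theorem polSph_eq_iSup (hn : 0 < n) (d : ℕ) :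
    polSph n d = ⨆ k : Fin (d + 1), (sphHarm n k).toSubmodule := by
  refine le_antisymm ?_ (iSup_le fun k => sphHarm_le_polSph (Nat.lt_succ_iff.1 k.2))
  rintro _ ⟨p, hp, rfl⟩
  have hp : p.totalDegree ≤ d := (mem_restrictTotalDegree _ _ _).1 hp
  rw [← sum_homogeneousComponent p, map_sum]
  refine Submodule.sum_mem _ fun k hk => ?_
  have hk : k ≤ d := by have := Finset.mem_range.1 hk; omega
  have h1 := mem_harmonicProducts hn k (homogeneousComponent_isHomogeneous k p)
  suffices harmonicProducts n k ≤
      (⨆ k : Fin (d + 1), (sphHarm n k).toSubmodule).comap (restr n) from this h1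
  refine Submodule.span_le.2 ?_
  rintro _ ⟨m, j, hmj, h, hh, rfl⟩
  rw [SetLike.mem_coe, Submodule.mem_comap]
  rw [restr_normSqPoly_pow_mul]
  exact Submodule.mem_iSup_of_mem ⟨j, by omega⟩ ⟨h, hh, rfl⟩

/-- The gradient (1, i, 0, …, 0) of the linear form is isotropic, so Δ kills all its powers. They
equal 1 at the first basis vector, which shows H_k ≠ 0. -/
theorem pow_mem_harm (hn : 2 ≤ n) (k : ℕ) :
    (X ⟨0, by omega⟩ + C Complex.I * X ⟨1, by omega⟩ : MvPolynomial (Fin n) ℂ) ^ k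
      ∈ harm n k := by
  set i0 : Fin n := ⟨0, by omega⟩
  set i1 : Fin n := ⟨1, by omega⟩
  have h01 : i0 ≠ i1 := by simp [i0, i1]
  refine ⟨?_, ?_⟩
  · have := ((isHomogeneous_X ℂ i0).add (isHomogeneous_C_mul_X Complex.I i1)).pow k
    simpa using this
  · change lap n _ = 0
    set c : Fin n → ℂ := fun i => (if i = i0 then 1 else 0) + (if i = i1 then Complex.I else 0)
    have hL : ∀ i, pderiv i (X i0 + C Complex.I * X i1 : MvPolynomial (Fin n) ℂ) = C (c i) := by
      intro i
      rw [map_add, pderiv_C_mul, pderiv_X, pderiv_X, Pi.single_apply, Pi.single_apply]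
      simp only [eq_comm (b := i), map_add, c]
      split_ifs <;> simp
    set L : MvPolynomial (Fin n) ℂ := X i0 + C Complex.I * X i1
    have hp : ∀ (i) (m : ℕ), pderiv i (L ^ m) = C (m * c i) * L ^ (m - 1) := by
      intro i m
      rw [Derivation.leibniz_pow, hL, smul_eq_mul, nsmul_eq_mul, map_mul, map_natCast]
      ring
    have h2 : ∀ i, pderiv i (pderiv i (L ^ k)) =
        C (c i ^ 2) * (C (k * (k - 1 : ℕ) : ℂ) * L ^ (k - 1 - 1)) := by
      intro i
      rw [hp, pderiv_C_mul, hp, ← mul_assoc, ← mul_assoc, ← map_mul, ← map_mul]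
      congr 2
      ring
    have hc : ∑ i, c i ^ 2 = 0 := by
      have : ∀ i, c i ^ 2 = (if i = i0 then 1 else 0) + (if i = i1 then -1 else 0) := by
        intro i
        simp only [c]
        split_ifs with h h' <;> simp_all
      simp [this, Finset.sum_add_distrib]
    rw [lap_apply]
    simp only [h2]
    rw [← Finset.sum_mul, ← map_sum, hc]
    simp

theorem sphHarm_ne_bot (hn : 2 ≤ n) (k : ℕ) : (sphHarm n k).toSubmodule ≠ ⊥ := by
  intro h
  have h1 := Submodule.mem_map_of_mem (f := restr n) (pow_mem_harm hn k)
  change restr n _ ∈ (sphHarm n k).toSubmodule at h1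
  rw [h, Submodule.mem_bot] at h1
  have h2 := DFunLike.congr_fun h1
    ⟨EuclideanSpace.single ⟨0, by omega⟩ (1 : ℝ), by simp⟩
  simp [restr_apply] at h2

/-! ### Infinitesimal rotations and their sum of squares -/

/-- The infinitesimal rotation `xᵢ ∂ⱼ - xⱼ ∂ᵢ`. -/
def angular (i j : Fin n) :
    Derivation ℂ (MvPolynomial (Fin n) ℂ) (MvPolynomial (Fin n) ℂ) :=
  (X i : MvPolynomial (Fin n) ℂ) • pderiv j - (X j : MvPolynomial (Fin n) ℂ) • pderiv i

theorem angular_apply (i j : Fin n) (p : MvPolynomial (Fin n) ℂ) :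
    angular i j p = X i * pderiv j p - X j * pderiv i p := by
  simp [angular]

/-- With E the Euler operator, the sum expands to 2(r²Δ - E² - (n - 2)E); the 2 appears because
ordered pairs count each coordinate plane twice. -/
theorem sum_angular_angular {k : ℕ} {p : MvPolynomial (Fin n) ℂ} (hp : p ∈ harm n k) :
    ∑ i, ∑ j, angular i j (angular i j p) = (-2 * k * (k + n - 2) : ℂ) • p := by
  have hE := hp.1.sum_X_mul_pderiv
  have hE2 : ∀ i, ∑ j, X j * pderiv j (pderiv i p) = (k - 1) • pderiv i p := fun i =>
    hp.1.pderiv.sum_X_mul_pderiv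
  have hl : ∑ j, pderiv j (pderiv j p) = 0 := by rw [← lap_apply]; exact hp.2
  have h1 : ∑ i, ∑ j, X i * pderiv j (X i * pderiv j p) = C (k : ℂ) * p := by
    have : ∀ i j, X i * pderiv j (X i * pderiv j p) =
        (if j = i then X j * pderiv j p else 0) + X i ^ 2 * pderiv j (pderiv j p) := by
      intro i j
      rw [pderiv_mul, pderiv_X, Pi.single_apply]
      split_ifs with h h' h'
      · subst h; ring
      · exact absurd h.symm h'
      · exact absurd h'.symm h
      · ring
    simp only [this, Finset.sum_add_distrib, ← Finset.mul_sum, hl]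
    simpa using hE
  have h2 : ∑ i, ∑ j, X i * pderiv j (X j * pderiv i p) = C (k * (n + (k - 1))  : ℂ) * p := by
    have : ∀ i, ∑ j, X i * pderiv j (X j * pderiv i p) =
        C ((n + (k - 1 : ℕ) : ℕ) : ℂ) * (X i * pderiv i p) := by
      intro i
      simp only [pderiv_mul, pderiv_X_self, one_mul, ← Finset.mul_sum, Finset.sum_add_distrib, hE2]
      simp only [Finset.sum_const, Finset.card_univ, Fintype.card_fin, nsmul_eq_mul, map_natCast,
        Nat.cast_add, map_add]
      ring
    simp only [this, ← Finset.mul_sum, hE]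
    rw [nsmul_eq_mul, ← mul_assoc, ← map_natCast (C (σ := Fin n) (R := ℂ)), ← map_mul]
    congr 2
    -- The degree k - 1 of a derivative is a truncated subtraction; at k = 0 the outer factor k
    -- makes this harmless.
    cases k with
    | zero => simp
    | succ k => push_cast [Nat.add_sub_cancel]; ring
  have h3 : ∀ i j, angular i j (angular i j p) =
      (X i * pderiv j (X i * pderiv j p) - X i * pderiv j (X j * pderiv i p)) +
      (X j * pderiv i (X j * pderiv i p) - X j * pderiv i (X i * pderiv j p)) := by
    intro i j
    simp only [angular_apply, map_sub]
    ring
  simp only [h3, Finset.sum_add_distrib, Finset.sum_sub_distrib]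
  rw [h1, h2, Finset.sum_comm, h1, Finset.sum_comm, h2, smul_eq_C_mul]
  simp only [← sub_mul, ← add_mul, ← map_sub, ← map_add]
  congr 2
  ring

/-! ### Invariant measure and the L² inner product -/

instance : IsFiniteMeasure (surface n) := inferInstanceAs (IsFiniteMeasure (Measure.toSphere _))

instance : (surface n).IsOpenPosMeasure :=
  inferInstanceAs (Measure.IsOpenPosMeasure (Measure.toSphere _))

/-- The surface measure of s is a multiple of the volume of the cone (0, 1) • s, and u preserves
volume and carries cones to cones. -/
theorem measurePreserving_sphMap (u : Orth n) :
    MeasurePreserving (sphMap u) (surface n) (surface n) := by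
  refine ⟨(sphMap u).continuous.measurable, ?_⟩
  ext s hs
  rw [Measure.map_apply (sphMap u).continuous.measurable hs, surface, Measure.toSphere_apply' _ hs,
    Measure.toSphere_apply' _ ((sphMap u).continuous.measurable hs)]
  congr 1
  rw [← u.measurePreserving.measure_preimage_emb u.toMeasurableEquiv.measurableEmbedding
    (Set.Ioo (0 : ℝ) 1 • (Subtype.val '' s))]
  congr 1
  ext x
  simp only [Set.mem_smul, Set.mem_image, Set.mem_preimage]
  constructor
  · rintro ⟨r, hr, _, ⟨y, hy, rfl⟩, rfl⟩
    exact ⟨r, hr, _, ⟨_, hy, rfl⟩, by simp [sphMap]⟩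
  · rintro ⟨r, hr, _, ⟨y, hy, rfl⟩, h⟩
    refine ⟨r, hr, _, ⟨sphMap u.symm y, ?_, rfl⟩, ?_⟩
    · have : sphMap u (sphMap u.symm y) = y := by ext1; simp [sphMap]
      rwa [this]
    · apply u.injective
      simp [sphMap, h]

theorem integral_comp_sphMap (u : Orth n) (f : C(Sph n, ℂ)) :
    ∫ x, f.comp (sphMap u) x ∂(surface n) = ∫ x, f x ∂(surface n) := by
  conv_rhs => rw [← (measurePreserving_sphMap u).map_eq]
  rw [integral_map (sphMap u).continuous.aemeasurable
    f.continuous.aestronglyMeasurable]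
  rfl

theorem sphInner_sphRep (u : Orth n) (f g : C(Sph n, ℂ)) :
    sphInner (sphRep n u f) (sphRep n u g) = sphInner f g :=
  integral_comp_sphMap u⁻¹ (f * star g)

/-- The embedding of `C(Sⁿ⁻¹)` into the Hilbert space `L²(Sⁿ⁻¹)`. -/
def toL2 (n : ℕ) : C(Sph n, ℂ) →L[ℂ] Lp ℂ 2 (surface n) :=
  ContinuousMap.toLp 2 (surface n) ℂ

theorem inner_toL2 (f g : C(Sph n, ℂ)) : inner ℂ (toL2 n g) (toL2 n f) = sphInner f g :=
  ContinuousMap.inner_toLp (surface n) g f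

theorem toL2_injective (n : ℕ) : Function.Injective (toL2 n) :=
  ContinuousMap.toLp_injective (surface n)

theorem sphInner_self_eq_zero {f : C(Sph n, ℂ)} : sphInner f f = 0 ↔ f = 0 := by
  rw [← inner_toL2, inner_self_eq_zero, map_eq_zero_iff _ (toL2_injective n)]

/-- Integration over the sphere as a continuous linear functional. -/
def integralSph (n : ℕ) : C(Sph n, ℂ) →L[ℂ] ℂ := (innerSL ℂ (toL2 n 1)).comp (toL2 n)

theorem integralSph_apply (f : C(Sph n, ℂ)) : integralSph n f = ∫ x, f x ∂(surface n) := by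
  simp [integralSph, inner_toL2, sphInner]

theorem sphInner_eq_integralSph (f g : C(Sph n, ℂ)) :
    sphInner f g = integralSph n (f * star g) := by
  rw [integralSph_apply]; rfl

/-! ### Rotations and orthogonality of the H_k -/

/-- The unit vector at angle `t` in the plane of the coordinates `i` and `j`. -/
def planeVec (i j : Fin n) (t : ℝ) : Euc n :=
  Real.cos t • EuclideanSpace.single i 1 + Real.sin t • EuclideanSpace.single j 1

/-- The rotation of the plane of the coordinates `i` and `j` obtained by composing two
reflections. -/
def planeRot (i j : Fin n) (t : ℝ) : Orth n :=
  ((ℝ ∙ planeVec i j t)ᗮ.reflection).trans (ℝ ∙ planeVec i j 0)ᗮ.reflection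

theorem norm_planeVec {i j : Fin n} (hij : i ≠ j) (t : ℝ) : ‖planeVec i j t‖ = 1 := by
  have h : inner ℝ (planeVec i j t) (planeVec i j t) = 1 := by
    simp only [planeVec, inner_add_left, inner_add_right, real_inner_smul_left,
      real_inner_smul_right, EuclideanSpace.inner_single_left, PiLp.single_apply, hij, hij.symm]
    simp [← sq]
  rw [real_inner_self_eq_norm_sq] at h
  exact (pow_eq_one_iff_of_nonneg (norm_nonneg _) two_ne_zero).1 h

theorem reflection_orthogonal_unit {w : Euc n} (hw : ‖w‖ = 1) (x : Euc n) :
    (ℝ ∙ w)ᗮ.reflection x = x - (2 * inner ℝ w x) • w := by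
  rw [Submodule.reflection_orthogonal_apply, Submodule.reflection_singleton_apply, hw]
  simp [two_mul, add_smul, two_smul]

theorem planeRot_apply {i j : Fin n} (hij : i ≠ j) (t : ℝ) (x : Euc n) (k : Fin n) :
    planeRot i j t x k = x k +
      (-2 * (if k = i then 1 else 0) + 2 * Real.cos t * (Real.cos t * (if k = i then 1 else 0) -
        Real.sin t * (if k = j then 1 else 0))) * x i +
      (2 * Real.sin t * (Real.cos t * (if k = i then 1 else 0) -
        Real.sin t * (if k = j then 1 else 0))) * x j := by
  simp only [planeRot, LinearIsometryEquiv.trans_apply,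
    reflection_orthogonal_unit (norm_planeVec hij _)]
  simp only [planeVec, inner_add_left, inner_sub_right, inner_add_right, real_inner_smul_left,
    real_inner_smul_right, EuclideanSpace.inner_single_left, PiLp.single_apply, hij, hij.symm,
    PiLp.add_apply, PiLp.sub_apply, PiLp.smul_apply, smul_eq_mul, Real.cos_zero, Real.sin_zero]
  simp only [map_one, ↓reduceIte, one_mul, mul_one, mul_zero, add_zero, zero_mul]
  split_ifs <;> ring

/-- The two reflections compose to a rotation by -2t, whence the factor -2. The derivative is taken
in the Banach algebra of continuous functions, so the product rule reduces it to coordinates, and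
continuous functionals can be applied to it. -/
theorem hasDerivAt_restr_planeRot {i j : Fin n} (hij : i ≠ j) (p : MvPolynomial (Fin n) ℂ) :
    HasDerivAt (fun t => (restr n p).comp (sphMap (planeRot i j t)))
      (restr n ((-2 : ℂ) • angular i j p)) 0 := by
  have h0 : planeRot i j 0 = 1 := by
    ext x
    simp [planeRot]
  have h0' : ∀ f : C(Sph n, ℂ), f.comp (sphMap (planeRot i j 0)) = f := by
    intro f; rw [h0]; rfl
  induction p using MvPolynomial.induction_on with
  | C a =>
    have : ∀ t, (restr n (C a)).comp (sphMap (planeRot i j t)) = restr n (C a) := by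
      intro t; ext x; simp [restr_apply]
    simp only [this, angular_apply, pderiv_C]
    simpa using hasDerivAt_const (0 : ℝ) (restr n (C a))
  | add p q hp hq =>
    have h1 : ∀ t, (restr n (p + q)).comp (sphMap (planeRot i j t)) =
        (restr n p).comp (sphMap (planeRot i j t)) +
          (restr n q).comp (sphMap (planeRot i j t)) := by
      intro t; rw [map_add]; rfl
    simp only [h1]
    exact (hp.add hq).congr_deriv (by simp only [map_add, smul_add])
  | mul_X p k hp =>
    have hX : HasDerivAt (fun t => (restr n (X k)).comp (sphMap (planeRot i j t)))
        (restr n ((-2 : ℂ) • angular i j (X k))) 0 := by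
      have h1 : ∀ t, (restr n (X k)).comp (sphMap (planeRot i j t)) = restr n (X k) +
          (-2 * (if k = i then 1 else 0) + 2 * Real.cos t * (Real.cos t *
            (if k = i then 1 else 0) - Real.sin t * (if k = j then 1 else 0))) • restr n (X i) +
          (2 * Real.sin t * (Real.cos t * (if k = i then 1 else 0) -
            Real.sin t * (if k = j then 1 else 0))) • restr n (X j) := by
        intro t
        ext x
        have := planeRot_apply hij t (x : Euc n) k
        apply_fun ((↑) : ℝ → ℂ) at this
        simp only [ContinuousMap.comp_apply, ContinuousMap.add_apply, ContinuousMap.smul_apply,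
          restr_apply, eval_X, Complex.real_smul]
        rw [← Complex.ofReal_mul, ← Complex.ofReal_mul, ← Complex.ofReal_add,
          ← Complex.ofReal_add]
        exact this
      simp only [h1]
      have hc := Real.hasDerivAt_cos 0
      have hs := Real.hasDerivAt_sin 0
      have hd := (hc.mul_const (if k = i then (1 : ℝ) else 0)).sub
        (hs.mul_const (if k = j then (1 : ℝ) else 0))
      have ha := (((hc.const_mul 2).mul hd).const_add (-2 * (if k = i then (1 : ℝ) else 0)))
      have hb := (hs.const_mul 2).mul hd
      replace ha := ha.congr_deriv (g' := -2 * (if k = j then (1 : ℝ) else 0))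
        (by simp; split_ifs <;> simp)
      replace hb := hb.congr_deriv (g' := 2 * (if k = i then (1 : ℝ) else 0)) (by simp)
      refine (((ha.smul_const (restr n (X i))).const_add (restr n (X k))).add
        (hb.smul_const (restr n (X j)))).congr_deriv ?_
      rw [angular_apply, pderiv_X, pderiv_X, Pi.single_apply, Pi.single_apply]
      ext x
      split_ifs <;> (simp [restr_apply]; try ring)
    have := hp.mul hX
    simp only [h0'] at this
    have h2 : ∀ t, (restr n (p * X k)).comp (sphMap (planeRot i j t)) =
        (restr n p).comp (sphMap (planeRot i j t)) *
          (restr n (X k)).comp (sphMap (planeRot i j t)) := by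
      intro t; rw [restr_mul]; rfl
    simp only [h2]
    refine this.congr_deriv ?_
    rw [Derivation.leibniz, ← restr_mul, ← restr_mul, ← map_add]
    congr 1
    simp only [smul_eq_C_mul, smul_eq_mul]
    ring

/-- The integral of p over the rotated sphere does not depend on the angle, so its derivative at 0
vanishes. -/
theorem integralSph_angular (i j : Fin n) (p : MvPolynomial (Fin n) ℂ) :
    integralSph n (restr n (angular i j p)) = 0 := by
  by_cases hij : i = j
  · subst hij
    simp [angular_apply]
  · have h := ((integralSph n).restrictScalars ℝ).hasFDerivAt.comp_hasDerivAt (0 : ℝ)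
      (hasDerivAt_restr_planeRot hij p)
    have hc : ((integralSph n).restrictScalars ℝ ∘
        fun t => (restr n p).comp (sphMap (planeRot i j t))) =
        fun _ => integralSph n (restr n p) := by
      ext t
      simp only [Function.comp_apply, ContinuousLinearMap.coe_restrictScalars', integralSph_apply]
      exact integral_comp_sphMap _ _
    rw [hc] at h
    have := h.unique (hasDerivAt_const _ _)
    simpa using this

/-- For a derivation D, p D²q - q D²p = D(p Dq - q Dp), whose integral is zero. -/
theorem integralSph_angular_angular (i j : Fin n) (p q : MvPolynomial (Fin n) ℂ) :
    integralSph n (restr n (p * angular i j (angular i j q))) =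
      integralSph n (restr n (q * angular i j (angular i j p))) := by
  have := integralSph_angular i j (p * angular i j q - q * angular i j p)
  rw [← sub_eq_zero, ← this, ← map_sub, ← map_sub]
  congr 2
  simp only [map_sub, Derivation.leibniz, smul_eq_mul]
  ring

theorem integralSph_mul_eq_zero (hn : 2 ≤ n) {j k : ℕ} (hjk : j ≠ k)
    {p q : MvPolynomial (Fin n) ℂ} (hp : p ∈ harm n j) (hq : q ∈ harm n k) :
    integralSph n (restr n (p * q)) = 0 := by
  have h : ∑ a, ∑ b, integralSph n (restr n (p * angular a b (angular a b q))) =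
      ∑ a, ∑ b, integralSph n (restr n (q * angular a b (angular a b p))) := by
    simp only [integralSph_angular_angular _ _ p q]
  simp only [← map_sum, ← Finset.mul_sum, sum_angular_angular hp, sum_angular_angular hq,
    mul_smul_comm, map_smul, smul_eq_mul, mul_comm q p] at h
  rw [← sub_eq_zero, ← sub_mul, mul_eq_zero] at h
  refine h.resolve_left fun h' => ?_
  -- Equal eigenvalues force j = k or k + j + n = 2; as n ≥ 2, the latter also gives j = k = 0.
  have : ((k : ℂ) - j) * (k + j + n - 2) = 0 := by linear_combination (-1 / 2) * h'
  rcases mul_eq_zero.1 this with h1 | h1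
  · exact hjk (by exact_mod_cast (sub_eq_zero.1 h1).symm)
  · have : k + j + n = 2 := by exact_mod_cast sub_eq_zero.1 h1
    omega

/-- Coordinates are real on the sphere and Δ has real coefficients, so it suffices to conjugate the
coefficients. This turns bilinear orthogonality into Hermitian orthogonality. -/
theorem exists_star_restr_eq {k : ℕ} {p : MvPolynomial (Fin n) ℂ} (hp : p ∈ harm n k) :
    ∃ q ∈ harm n k, star (restr n p) = restr n q := by
  refine ⟨map (starRingEnd ℂ) p, ⟨hp.1.map _, ?_⟩, ?_⟩
  · have h0 : lap n p = 0 := hp.2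
    change lap n _ = 0
    rw [lap_apply] at h0 ⊢
    simp only [pderiv_map, ← map_sum, h0, map_zero]
  · ext x
    change (starRingEnd ℂ) (eval _ p) = eval _ (map (starRingEnd ℂ) p)
    rw [eval_map, ← coe_eval₂Hom, ← RingHom.comp_apply]
    congr 1
    ext <;> simp

theorem sphInner_eq_zero_of_ne (hn : 2 ≤ n) {j k : ℕ} (hjk : j ≠ k) {f g : C(Sph n, ℂ)}
    (hf : f ∈ (sphHarm n j).toSubmodule) (hg : g ∈ (sphHarm n k).toSubmodule) :
    sphInner f g = 0 := by
  obtain ⟨p, hp, rfl⟩ := hf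
  obtain ⟨q, hq, rfl⟩ := hg
  obtain ⟨q', hq', h⟩ := exists_star_restr_eq hq
  rw [sphInner_eq_integralSph, h, ← restr_mul]
  exact integralSph_mul_eq_zero hn hjk hp hq'

/-! ### Orthogonal complements and finite dimensionality -/

/-- The functions orthogonal to the subspace `W`. -/
def perp (W : Submodule ℂ C(Sph n, ℂ)) : Submodule ℂ C(Sph n, ℂ) :=
  (W.map (toL2 n).toLinearMap)ᗮ.comap (toL2 n).toLinearMap

theorem mem_perp {W : Submodule ℂ C(Sph n, ℂ)} {f : C(Sph n, ℂ)} :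
    f ∈ perp W ↔ ∀ g ∈ W, sphInner f g = 0 := by
  simp [perp, Submodule.mem_orthogonal, inner_toL2]

theorem disjoint_perp (W : Submodule ℂ C(Sph n, ℂ)) : Disjoint W (perp W) := by
  rw [Submodule.disjoint_def]
  intro f hf hf'
  exact sphInner_self_eq_zero.1 (mem_perp.1 hf' f hf)

theorem iSupIndep_sphHarm (hn : 2 ≤ n) : iSupIndep fun k : ℕ => (sphHarm n k).toSubmodule := by
  intro k
  refine (disjoint_perp _).mono_right (iSup₂_le fun j hjk f hf => ?_)
  exact mem_perp.2 fun g hg => sphInner_eq_zero_of_ne hn hjk hf hg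

instance finiteDimensional_restrictTotalDegree (n d : ℕ) :
    FiniteDimensional ℂ (restrictTotalDegree (Fin n) ℂ d) := by
  have hfin : {m : Fin n →₀ ℕ | (m.sum fun _ e => e) ≤ d}.Finite := by
    refine (Set.finite_Iic (Finsupp.equivFunOnFinite.symm fun _ : Fin n => d)).subset ?_
    intro m hm i
    by_cases hi : i ∈ m.support
    · exact (Finset.single_le_sum (f := m) (fun _ _ => Nat.zero_le _) hi).trans hm
    · simp [Finsupp.notMem_support_iff.1 hi]
  have hspan := hfin.image fun m => (monomial m (1 : ℂ) : MvPolynomial (Fin n) ℂ)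
  have := FiniteDimensional.span_of_finite ℂ hspan
  refine Submodule.finiteDimensional_of_le (S₂ := Submodule.span ℂ
    ((fun m => (monomial m (1 : ℂ) : MvPolynomial (Fin n) ℂ)) ''
      {m : Fin n →₀ ℕ | (m.sum fun _ e => e) ≤ d})) fun p hp => ?_
  rw [mem_restrictTotalDegree] at hp
  rw [p.as_sum]
  refine Submodule.sum_mem _ fun m hm => ?_
  rw [← mul_one (coeff m p), ← smul_eq_mul, ← smul_monomial]
  exact Submodule.smul_mem _ _ (Submodule.subset_span ⟨m, (le_totalDegree hm).trans hp, rfl⟩)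

instance finiteDimensional_polSph (n d : ℕ) : FiniteDimensional ℂ (polSph n d) :=
  Module.Finite.map (restrictTotalDegree (Fin n) ℂ d) (restr n)

instance finiteDimensional_sphHarm (n k : ℕ) :
    FiniteDimensional ℂ (sphHarm n k).toSubmodule :=
  Submodule.finiteDimensional_of_le (sphHarm_le_polSph le_rfl)

/-! ### Zonal functions from reproducing kernels -/

/-- The reflection exchanging x and y fixes the hyperplane orthogonal to x - y, which contains e.
Taking e = 0 gives transitivity on the sphere. -/
theorem exists_orth {e x y : Euc n} (hxy : ‖x‖ = ‖y‖) (he : inner ℝ e x = inner ℝ e y) :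
    ∃ u : Orth n, u e = e ∧ u x = y := by
  refine ⟨(ℝ ∙ (x - y))ᗮ.reflection, ?_, Submodule.reflection_sub hxy⟩
  apply Submodule.reflection_mem_subspace_eq_self
  rw [Submodule.mem_orthogonal_singleton_iff_inner_left, inner_sub_right, he, sub_self]

theorem exists_orth_apply_eq (x y : Sph n) : ∃ u : Orth n, u (x : Euc n) = y := by
  obtain ⟨u, -, hu⟩ := exists_orth (e := (0 : Euc n)) (x := x) (y := y) (by simp) (by simp)
  exact ⟨u, hu⟩

theorem sphRep_apply (u : Orth n) (f : C(Sph n, ℂ)) (x : Sph n) :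
    sphRep n u f x = f (sphMap u⁻¹ x) := rfl

theorem sphRep_apply_of_eq {u : Orth n} {x y : Sph n} (h : u (x : Euc n) = y)
    (f : C(Sph n, ℂ)) : sphRep n u f y = f x := by
  rw [sphRep_apply]
  congr 1
  ext1
  change u.symm (y : Euc n) = x
  rw [← h, LinearIsometryEquiv.symm_apply_apply]

theorem sphInner_sphRep_right (u : Orth n) (f g : C(Sph n, ℂ)) :
    sphInner f (sphRep n u g) = sphInner (sphRep n u⁻¹ f) g := by
  rw [← sphInner_sphRep u⁻¹, ← Module.End.mul_apply, ← map_mul, inv_mul_cancel, map_one]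
  rfl

theorem apply_eq_of_mem_zonal {e x y : Sph n} {f : C(Sph n, ℂ)} (hf : f ∈ zonal e)
    (h : inner ℝ (e : Euc n) (x : Euc n) = inner ℝ (e : Euc n) (y : Euc n)) : f x = f y := by
  obtain ⟨u, hue, hux⟩ := exists_orth (x := (x : Euc n)) (y := y) (by simp) h
  rw [← sphRep_apply_of_eq hux f, hf u hue]

/-- Evaluation at e is not L²-continuous on all continuous functions, but it is on a
finite-dimensional space, where Riesz representation applies. -/
theorem exists_reproducing (W : Submodule ℂ C(Sph n, ℂ)) [FiniteDimensional ℂ W] (e : Sph n) :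
    ∃ ζ ∈ W, ∀ f ∈ W, sphInner f ζ = f e := by
  let E := Submodule.equivMapOfInjective (toL2 n).toLinearMap (toL2_injective n) W
  have : FiniteDimensional ℂ (W.map (toL2 n).toLinearMap) := inferInstance
  let φ : W.map (toL2 n).toLinearMap →ₗ[ℂ] ℂ :=
    (ContinuousMap.evalCLM ℂ e).toLinearMap ∘ₗ W.subtype ∘ₗ E.symm.toLinearMap
  have : CompleteSpace (W.map (toL2 n).toLinearMap) := FiniteDimensional.complete ℂ _
  obtain ⟨ζ, hζ⟩ := E.surjective
    ((InnerProductSpace.toDual ℂ _).symm (LinearMap.toContinuousLinearMap φ))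
  refine ⟨ζ, ζ.2, fun f hf => ?_⟩
  have := InnerProductSpace.toDual_symm_apply (𝕜 := ℂ) (x := E ⟨f, hf⟩)
    (y := LinearMap.toContinuousLinearMap φ)
  rw [← hζ] at this
  rw [← inner_toL2]
  refine this.trans ?_
  simp [φ]

/-- A nonzero finite-dimensional invariant subspace contains a zonal function which does not
vanish at its pole. -/
theorem exists_zonal (W : Submodule ℂ C(Sph n, ℂ)) [FiniteDimensional ℂ W]
    (hW : ∀ (u : Orth n), ∀ f ∈ W, sphRep n u f ∈ W) (h0 : W ≠ ⊥) (e : Sph n) :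
    ∃ ζ ∈ W, ζ ∈ zonal e ∧ ζ e ≠ 0 := by
  obtain ⟨ζ, hζ, h⟩ := exists_reproducing W e
  refine ⟨ζ, hζ, fun u hu => ?_, fun he => h0 ?_⟩
  -- Pairing f with u ζ evaluates u⁻¹ f at e, which is f(e). Hence u ζ - ζ lies in W and is
  -- orthogonal to W.
  · have h1 : ∀ f ∈ W, sphInner f (sphRep n u ζ - ζ) = 0 := by
      intro f hf
      have hu' : u⁻¹ (e : Euc n) = e := by
        conv_lhs => rw [← hu]
        exact u.symm_apply_apply _
      rw [← inner_toL2, map_sub, inner_sub_left, inner_toL2, inner_toL2,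
        sphInner_sphRep_right, h _ (hW _ _ hf), h f hf, sphRep_apply_of_eq hu', sub_self]
    exact sub_eq_zero.1 (sphInner_self_eq_zero.1 (h1 _ (W.sub_mem (hW u ζ hζ) hζ)))
  -- Since ζ(e) = (ζ, ζ), vanishing gives ζ = 0; then all of W vanishes at e, and by transitivity
  -- everywhere.
  · rw [← h ζ hζ, sphInner_self_eq_zero] at he
    rw [eq_bot_iff]
    intro f hf
    rw [Submodule.mem_bot]
    ext x
    obtain ⟨u, hu⟩ := exists_orth_apply_eq x e
    rw [← sphRep_apply_of_eq hu, ← h _ (hW u f hf), he]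
    simp [sphInner]

/-! ### Zonal polynomials as polynomials in ⟨e, x⟩ -/

/-- The function `x ↦ A(⟨e, x⟩)` on the sphere. -/
def ridge (e : Sph n) : Polynomial ℂ →ₗ[ℂ] C(Sph n, ℂ) where
  toFun A :=
    { toFun := fun x => A.eval ((inner ℝ (e : Euc n) (x : Euc n) : ℝ) : ℂ)
      continuous_toFun := A.continuous.comp (by fun_prop) }
  map_add' A B := by ext x; simp
  map_smul' c A := by ext x; simp

/-- Replacing s² by 1 - t² leaves degree at most one in s. Monomials are treated first because
multiplying by a variable raises the degree by exactly one, which keeps the bounds on A and B. -/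
theorem exists_meridian_monomial (a b : Fin n → ℂ) (m : Fin n →₀ ℕ) (c : ℂ) :
    ∀ d, (monomial m c).totalDegree ≤ d →
      ∃ A ∈ Polynomial.degreeLT ℂ (d + 1), ∃ B ∈ Polynomial.degreeLT ℂ d,
        ∀ t s : ℂ, t ^ 2 + s ^ 2 = 1 →
          eval (fun i => a i * t + b i * s) (monomial m c) = A.eval t + s * B.eval t := by
  refine MvPolynomial.induction_on_monomial (motive := fun p => ∀ d, p.totalDegree ≤ d →
      ∃ A ∈ Polynomial.degreeLT ℂ (d + 1), ∃ B ∈ Polynomial.degreeLT ℂ d,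
        ∀ t s : ℂ, t ^ 2 + s ^ 2 = 1 →
          eval (fun i => a i * t + b i * s) p = A.eval t + s * B.eval t) ?_ ?_ m c
  · intro c d _
    refine ⟨Polynomial.C c, ?_, 0, Submodule.zero_mem _, by simp⟩
    rw [Polynomial.mem_degreeLT]
    exact Polynomial.degree_C_le.trans_lt (by exact_mod_cast Nat.succ_pos d)
  · intro p i ih d hd
    by_cases hp : p = 0
    · exact ⟨0, Submodule.zero_mem _, 0, Submodule.zero_mem _, by simp [hp]⟩
    rw [totalDegree_mul_of_isDomain hp (X_ne_zero i), totalDegree_X] at hd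
    obtain ⟨d, rfl⟩ : ∃ d', d = d' + 1 := ⟨d - 1, by omega⟩
    obtain ⟨A, hA, B, hB, h⟩ := ih d (by omega)
    have hX : ∀ {l : ℕ} {Q : Polynomial ℂ}, Q ∈ Polynomial.degreeLT ℂ l →
        Polynomial.X * Q ∈ Polynomial.degreeLT ℂ (l + 1) := by
      intro l Q hQ
      rw [Polynomial.mem_degreeLT, Polynomial.degree_lt_iff_coeff_zero] at hQ ⊢
      intro m hm
      obtain ⟨m, rfl⟩ : ∃ m', m = m' + 1 := ⟨m - 1, by omega⟩
      rw [Polynomial.coeff_X_mul]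
      exact hQ m (by omega)
    have hle : ∀ {l l' : ℕ}, l ≤ l' → Polynomial.degreeLT ℂ l ≤ Polynomial.degreeLT ℂ l' :=
      fun h => Polynomial.degreeLT_mono h
    -- These are the parts of (aᵢt + bᵢs)(A + sB) without and with s, after s² = 1 - t².
    refine ⟨a i • (Polynomial.X * A) + b i • (B - Polynomial.X * (Polynomial.X * B)), ?_,
      a i • (Polynomial.X * B) + b i • A, ?_, ?_⟩
    · exact add_mem (Submodule.smul_mem _ _ (hX hA)) (Submodule.smul_mem _ _
        (sub_mem (hle (by omega) hB) (hX (hX hB))))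
    · exact add_mem (Submodule.smul_mem _ _ (hX hB)) (Submodule.smul_mem _ _ hA)
    · intro t s hts
      simp only [map_mul, eval_X, h t s hts, Polynomial.eval_add, Polynomial.eval_sub,
        Polynomial.eval_smul, Polynomial.eval_mul, Polynomial.eval_X, smul_eq_mul]
      linear_combination (b i * B.eval t) * hts

theorem exists_meridian (a b : Fin n → ℂ) {d : ℕ} {p : MvPolynomial (Fin n) ℂ}
    (hp : p.totalDegree ≤ d) :
    ∃ A ∈ Polynomial.degreeLT ℂ (d + 1), ∃ B ∈ Polynomial.degreeLT ℂ d,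
      ∀ t s : ℂ, t ^ 2 + s ^ 2 = 1 →
        eval (fun i => a i * t + b i * s) p = A.eval t + s * B.eval t := by
  rw [p.as_sum]
  refine Finset.sum_induction _ (fun p => ∃ A ∈ Polynomial.degreeLT ℂ (d + 1),
    ∃ B ∈ Polynomial.degreeLT ℂ d, ∀ t s : ℂ, t ^ 2 + s ^ 2 = 1 →
      eval (fun i => a i * t + b i * s) p = A.eval t + s * B.eval t) ?_ ?_ ?_
  · rintro p q ⟨A, hA, B, hB, h⟩ ⟨A', hA', B', hB', h'⟩
    refine ⟨A + A', add_mem hA hA', B + B', add_mem hB hB', fun t s hts => ?_⟩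
    rw [map_add, h t s hts, h' t s hts, Polynomial.eval_add, Polynomial.eval_add]
    ring
  · exact ⟨0, Submodule.zero_mem _, 0, Submodule.zero_mem _, by simp⟩
  · intro m hm
    refine exists_meridian_monomial a b m _ d ?_
    exact (totalDegree_monomial_le m _).trans ((le_totalDegree hm).trans hp)

theorem exists_orthogonal_unit (hn : 2 ≤ n) (e : Sph n) :
    ∃ v : Euc n, ‖v‖ = 1 ∧ inner ℝ (e : Euc n) v = 0 := by
  have : (ℝ ∙ (e : Euc n))ᗮ ≠ ⊥ := by
    intro h
    have h1 := Submodule.finrank_add_finrank_orthogonal (ℝ ∙ (e : Euc n))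
    rw [h, finrank_bot, finrank_euclideanSpace_fin,
      finrank_span_singleton (ne_zero_of_mem_unit_sphere e)] at h1
    omega
  obtain ⟨v, hv, hv0⟩ := Submodule.exists_mem_ne_zero_of_ne_bot this
  refine ⟨‖v‖⁻¹ • v, norm_smul_inv_norm hv0, ?_⟩
  rw [real_inner_smul_right, Submodule.mem_orthogonal_singleton_iff_inner_right.1 hv, mul_zero]

/-- On the great circle te + sv the function has the form A(t) + sB(t). A zonal function takes the
same value at s and -s, and averaging leaves A(t). -/
theorem zonal_inf_polSph_le (hn : 2 ≤ n) (e : Sph n) (d : ℕ) :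
    zonal e ⊓ polSph n d ≤ (Polynomial.degreeLT ℂ (d + 1)).map (ridge e) := by
  rintro _ ⟨hf, p, hp, rfl⟩
  obtain ⟨v, hv, hev⟩ := exists_orthogonal_unit hn e
  obtain ⟨A, hA, B, hB, h⟩ := exists_meridian (fun i => (((e : Euc n) i : ℝ) : ℂ))
    (fun i => ((v i : ℝ) : ℂ)) ((mem_restrictTotalDegree _ _ _).1 hp)
  refine ⟨A, hA, ?_⟩
  have hee : inner ℝ (e : Euc n) (e : Euc n) = 1 := by simp
  have hvv : inner ℝ v v = (1 : ℝ) := by simp [hv]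
  have hve : inner ℝ v (e : Euc n) = (0 : ℝ) := by rw [real_inner_comm, hev]
  -- The point te + sv has the same inner product with e as x, so zonality moves x onto the great
  -- circle, for either sign of s.
  have key : ∀ (x : Sph n) (s : ℝ), inner ℝ (e : Euc n) (x : Euc n) ^ 2 + s ^ 2 = 1 →
      restr n p x = A.eval ((inner ℝ (e : Euc n) (x : Euc n) : ℝ) : ℂ) +
        s * B.eval ((inner ℝ (e : Euc n) (x : Euc n) : ℝ) : ℂ) := by
    intro x s hs
    set t : ℝ := inner ℝ (e : Euc n) (x : Euc n) with ht
    have hy : ‖t • (e : Euc n) + s • v‖ = 1 := by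
      refine (pow_eq_one_iff_of_nonneg (norm_nonneg _) two_ne_zero).1 ?_
      rw [← real_inner_self_eq_norm_sq]
      simp only [inner_add_left, inner_add_right, real_inner_smul_left, real_inner_smul_right,
        hee, hvv, hve, hev]
      linear_combination hs
    have h1 := apply_eq_of_mem_zonal (x := x) (y := ⟨t • (e : Euc n) + s • v, by simpa using hy⟩)
      hf (by simp only [inner_add_right, real_inner_smul_right, hee, hev, ← ht]; ring)
    rw [h1, ← h t s (by exact_mod_cast hs), restr_apply]
    congr 2
    ext i
    simp [mul_comm]
  ext x
  set t : ℝ := inner ℝ (e : Euc n) (x : Euc n) with ht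
  have ht1 : t ^ 2 ≤ 1 := by
    have := abs_real_inner_le_norm (e : Euc n) (x : Euc n)
    rw [norm_eq_of_mem_sphere, norm_eq_of_mem_sphere, mul_one, ← ht] at this
    exact (sq_le_one_iff_abs_le_one t).2 this
  have hs := Real.sq_sqrt (sub_nonneg.2 ht1)
  have h1 := key x (Real.sqrt (1 - t ^ 2)) (by rw [hs, ← ht]; ring)
  have h2 := key x (-Real.sqrt (1 - t ^ 2)) (by rw [neg_sq, hs, ← ht]; ring)
  push_cast at h2
  change A.eval ((t : ℝ) : ℂ) = _
  linear_combination (-1 / 2) * h1 + (-1 / 2) * h2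

/-! ### Dimension count for zonal functions -/

theorem finrank_zonal_inf_polSph_le (hn : 2 ≤ n) (e : Sph n) (d : ℕ) :
    Module.finrank ℂ ↥(zonal e ⊓ polSph n d) ≤ d + 1 := by
  have hE := Polynomial.degreeLTEquiv ℂ (d + 1)
  have : FiniteDimensional ℂ (Polynomial.degreeLT ℂ (d + 1)) := hE.symm.finiteDimensional
  calc _ ≤ Module.finrank ℂ ((Polynomial.degreeLT ℂ (d + 1)).map (ridge e)) :=
        Submodule.finrank_mono (zonal_inf_polSph_le hn e d)
    _ ≤ Module.finrank ℂ (Polynomial.degreeLT ℂ (d + 1)) := Submodule.finrank_map_le _ _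
    _ = d + 1 := by rw [hE.finrank_eq]; simp

instance finiteDimensional_zonal_inf_sphHarm (e : Sph n) (k : ℕ) :
    FiniteDimensional ℂ ↥(zonal e ⊓ (sphHarm n k).toSubmodule) :=
  Submodule.finiteDimensional_of_le inf_le_right

theorem one_le_finrank_zonal_inf_sphHarm (hn : 2 ≤ n) (e : Sph n) (k : ℕ) :
    1 ≤ Module.finrank ℂ ↥(zonal e ⊓ (sphHarm n k).toSubmodule) := by
  obtain ⟨ζ, hζ, hz, h0⟩ := exists_zonal _ (fun u f hf => (sphHarm n k).2 u hf)
    (sphHarm_ne_bot hn k) e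
  rw [Nat.one_le_iff_ne_zero, Ne, Submodule.finrank_eq_zero]
  intro h
  have : ζ ∈ zonal e ⊓ (sphHarm n k).toSubmodule := ⟨hz, hζ⟩
  rw [h, Submodule.mem_bot] at this
  exact h0 (by simp [this])

theorem disjoint_polSph_sphHarm (hn : 2 ≤ n) (d : ℕ) :
    Disjoint (polSph n d) (sphHarm n (d + 1)).toSubmodule := by
  rw [polSph_eq_iSup (by omega)]
  refine ((iSupIndep_sphHarm hn) (d + 1)).symm.mono_left (iSup_le fun k => ?_)
  exact le_iSup₂_of_le (k : ℕ) (by have := k.2; omega) le_rfl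

theorem finrank_zonal_add_le (hn : 2 ≤ n) (e : Sph n) (d : ℕ) :
    Module.finrank ℂ ↥(zonal e ⊓ polSph n d) +
      Module.finrank ℂ ↥(zonal e ⊓ (sphHarm n (d + 1)).toSubmodule) ≤
        Module.finrank ℂ ↥(zonal e ⊓ polSph n (d + 1)) := by
  have h1 : FiniteDimensional ℂ ↥(zonal e ⊓ polSph n d) :=
    Submodule.finiteDimensional_of_le inf_le_right
  have h2 : FiniteDimensional ℂ ↥(zonal e ⊓ polSph n (d + 1)) :=
    Submodule.finiteDimensional_of_le inf_le_right
  rw [← Submodule.finrank_sup_add_finrank_inf_eq, ((disjoint_polSph_sphHarm hn d).mono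
    inf_le_right inf_le_right).eq_bot, finrank_bot, add_zero]
  refine Submodule.finrank_mono (sup_le (inf_le_inf_left _ ?_)
    (inf_le_inf_left _ (sphHarm_le_polSph le_rfl)))
  refine Submodule.map_mono fun p hp => ?_
  rw [mem_restrictTotalDegree] at hp ⊢
  omega

theorem le_finrank_zonal_inf_polSph (hn : 2 ≤ n) (e : Sph n) (d : ℕ) :
    d + 1 ≤ Module.finrank ℂ ↥(zonal e ⊓ polSph n d) := by
  induction d with
  | zero =>
    have h2 : FiniteDimensional ℂ ↥(zonal e ⊓ polSph n 0) :=
      Submodule.finiteDimensional_of_le inf_le_right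
    exact (one_le_finrank_zonal_inf_sphHarm hn e 0).trans
      (Submodule.finrank_mono (inf_le_inf_left _ (sphHarm_le_polSph le_rfl)))
  | succ d ih =>
    have := finrank_zonal_add_le hn e d
    have := one_le_finrank_zonal_inf_sphHarm hn e (d + 1)
    omega

/-- In degree at most d there are already d + 1 dimensions of zonal functions, and in degree at most
d + 1 at most d + 2, so H_{d+1} contributes at most one. -/
theorem finrank_zonal_inf_sphHarm (hn : 2 ≤ n) (e : Sph n) (k : ℕ) :
    Module.finrank ℂ ↥(zonal e ⊓ (sphHarm n k).toSubmodule) = 1 := by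
  refine le_antisymm ?_ (one_le_finrank_zonal_inf_sphHarm hn e k)
  cases k with
  | zero =>
    have h2 : FiniteDimensional ℂ ↥(zonal e ⊓ polSph n 0) :=
      Submodule.finiteDimensional_of_le inf_le_right
    exact (Submodule.finrank_mono (inf_le_inf_left _ (sphHarm_le_polSph le_rfl))).trans
      (finrank_zonal_inf_polSph_le hn e 0)
  | succ d =>
    have := finrank_zonal_add_le hn e d
    have := le_finrank_zonal_inf_polSph hn e d
    have := finrank_zonal_inf_polSph_le hn e (d + 1)
    omega

theorem exists_smul_eq_of_mem {K V : Type*} [DivisionRing K] [AddCommGroup V] [Module K V]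
    {P : Submodule K V} (hP : Module.finrank K P = 1) {f g : V} (hf : f ∈ P) (hf0 : f ≠ 0)
    (hg : g ∈ P) : ∃ c : K, c • f = g := by
  obtain ⟨c, hc⟩ := exists_smul_eq_of_finrank_eq_one hP (x := ⟨f, hf⟩)
    (fun h => hf0 (congrArg Subtype.val h)) ⟨g, hg⟩
  exact ⟨c, congrArg Subtype.val hc⟩

theorem exists_smul_eq_of_zonal (hn : 2 ≤ n) {e : Sph n} {k : ℕ} {f g : C(Sph n, ℂ)}
    (hf : f ∈ zonal e) (hf' : f ∈ (sphHarm n k).toSubmodule) (hf0 : f ≠ 0)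
    (hg : g ∈ zonal e) (hg' : g ∈ (sphHarm n k).toSubmodule) : ∃ c : ℂ, c • f = g := by
  exact exists_smul_eq_of_mem (finrank_zonal_inf_sphHarm hn e k) ⟨hf, hf'⟩ hf0 ⟨hg, hg'⟩

/-! ### Irreducibility and inequivalence -/

theorem exists_sub_mem_perp (W : Submodule ℂ C(Sph n, ℂ)) [FiniteDimensional ℂ W]
    (f : C(Sph n, ℂ)) : ∃ g ∈ W, f - g ∈ perp W := by
  obtain ⟨g, hg, h⟩ := (W.map (toL2 n).toLinearMap).starProjection_apply_mem (toL2 n f)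
  refine ⟨g, hg, ?_⟩
  have := (W.map (toL2 n).toLinearMap).sub_starProjection_mem_orthogonal (toL2 n f)
  rw [← h] at this
  simpa [perp] using this

/-- If the complement of W in H_k were nonzero, it and W would each contain a nonzero zonal
function. These are proportional, so W would meet its complement. -/
theorem eq_of_invariant_le (hn : 2 ≤ n) {k : ℕ} {W : Submodule ℂ C(Sph n, ℂ)}
    (hle : W ≤ (sphHarm n k).toSubmodule)
    (hW : ∀ (u : Orth n), ∀ f ∈ W, sphRep n u f ∈ W) (h0 : W ≠ ⊥) :
    W = (sphHarm n k).toSubmodule := by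
  have : FiniteDimensional ℂ W := Submodule.finiteDimensional_of_le hle
  let e : Sph n := ⟨EuclideanSpace.single ⟨0, by omega⟩ (1 : ℝ), by simp⟩
  have hperp : perp W ⊓ (sphHarm n k).toSubmodule = ⊥ := by
    by_contra h
    have : FiniteDimensional ℂ ↥(perp W ⊓ (sphHarm n k).toSubmodule) :=
      Submodule.finiteDimensional_of_le inf_le_right
    obtain ⟨ζ, hζ, hz, hζ0⟩ := exists_zonal W hW h0 e
    obtain ⟨η, hη, hz', hη0⟩ := exists_zonal (perp W ⊓ (sphHarm n k).toSubmodule)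
      (fun u f hf => ⟨mem_perp.2 fun g hg => by
        rw [← inv_inv u, ← sphInner_sphRep_right]
        exact mem_perp.1 hf.1 _ (hW _ g hg), (sphHarm n k).2 u hf.2⟩) h e
    obtain ⟨c, hc⟩ := exists_smul_eq_of_zonal hn hz (hle hζ) (by rintro rfl; simp at hζ0) hz' hη.2
    have : η ∈ W := hc ▸ W.smul_mem c hζ
    have := (Submodule.disjoint_def.1 (disjoint_perp W)) η this hη.1
    simp [this] at hη0
  refine le_antisymm hle fun f hf => ?_
  obtain ⟨g, hg, h⟩ := exists_sub_mem_perp W f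
  have : f - g ∈ perp W ⊓ (sphHarm n k).toSubmodule := ⟨h, sub_mem hf (hle hg)⟩
  rw [hperp, Submodule.mem_bot, sub_eq_zero] at this
  exact this ▸ hg

theorem isIrreducible_sphHarm (hn : 2 ≤ n) (k : ℕ) :
    Representation.IsIrreducible (V := ↥(sphHarm n k).toSubmodule)
      (sphHarm n k).toRepresentation where
  exists_pair_ne := by
    refine ⟨⊥, ⊤, fun h => ?_⟩
    have h1 := congrArg Subrepresentation.toSubmodule h
    change (⊥ : Submodule ℂ (sphHarm n k).toSubmodule) = ⊤ at h1
    exact sphHarm_ne_bot hn k (Submodule.subsingleton_iff_eq_bot.1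
      ((Submodule.subsingleton_iff ℂ).1 (subsingleton_of_bot_eq_top h1)))
  eq_bot_or_eq_top σ := by
    by_cases h : σ.toSubmodule.map (sphHarm n k).toSubmodule.subtype = ⊥
    · left
      apply Subrepresentation.toSubmodule_injective
      exact Submodule.map_injective_of_injective (Submodule.subtype_injective _)
        (h.trans (Submodule.map_bot _).symm)
    · right
      apply Subrepresentation.toSubmodule_injective
      have h1 := eq_of_invariant_le hn (Submodule.map_subtype_le _ _) (by
        rintro u _ ⟨f, hf, rfl⟩
        exact ⟨_, σ.2 u hf, rfl⟩) h
      change σ.toSubmodule = ⊤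
      apply Submodule.map_injective_of_injective (Submodule.subtype_injective _)
      rw [h1, Submodule.map_subtype_top]

/-- The graph-like space {f + cφ(f)} is invariant, and its zonal functions are multiples of ζ +
cφ(ζ). A suitable c makes this vanish at e, contradicting `exists_zonal`. -/
theorem isEmpty_equiv_sphHarm (hn : 2 ≤ n) {j k : ℕ} (hjk : j ≠ k) :
    IsEmpty ((sphHarm n j).toRepresentation.Equiv (sphHarm n k).toRepresentation) := by
  refine ⟨fun φ => ?_⟩
  have hφ : ∀ (u : Orth n) (f : (sphHarm n j).toSubmodule),
      (φ ((sphHarm n j).toRepresentation u f) : C(Sph n, ℂ)) = sphRep n u (φ f) := by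
    intro u f
    exact congrArg Subtype.val (LinearMap.congr_fun (φ.toIntertwiningMap.2 u) f)
  let e : Sph n := ⟨EuclideanSpace.single ⟨0, by omega⟩ (1 : ℝ), by simp⟩
  have hdisj : ∀ f ∈ (sphHarm n j).toSubmodule, f ∈ (sphHarm n k).toSubmodule → f = 0 :=
    Submodule.disjoint_def.1 ((iSupIndep_sphHarm hn).pairwiseDisjoint hjk)
  obtain ⟨ζ, hζ, hz, hζ0⟩ := exists_zonal _ (fun u f hf => (sphHarm n j).2 u hf)
    (sphHarm_ne_bot hn j) e
  obtain ⟨η, hη, hz', hη0⟩ := exists_zonal _ (fun u f hf => (sphHarm n k).2 u hf)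
    (sphHarm_ne_bot hn k) e
  have hζne : ζ ≠ 0 := by rintro rfl; simp at hζ0
  obtain ⟨a, ha⟩ := exists_smul_eq_of_zonal hn (g := (φ ⟨ζ, hζ⟩ : C(Sph n, ℂ))) hz' hη
    (by rintro rfl; simp at hη0)
    (fun u hu => by
      rw [← hφ]
      congr 2
      exact Subtype.ext (hz u hu))
    (φ ⟨ζ, hζ⟩).2
  have ha0 : a ≠ 0 := by
    rintro rfl
    have h0 : φ ⟨ζ, hζ⟩ = 0 := Subtype.ext (ha.symm.trans (zero_smul ℂ η))
    exact hζne (congrArg Subtype.val ((map_eq_zero_iff φ φ.toLinearEquiv.injective).1 h0))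
  -- Chosen so that ζ + cφ(ζ) = ζ + caη is zero at e.
  let c : ℂ := -ζ e / (a * η e)
  let T : (sphHarm n j).toSubmodule →ₗ[ℂ] C(Sph n, ℂ) := (sphHarm n j).toSubmodule.subtype +
    c • ((sphHarm n k).toSubmodule.subtype ∘ₗ φ.toLinearMap)
  have hT : ∀ f, T f = f + c • (φ f : C(Sph n, ℂ)) := fun f => rfl
  have hTrep : ∀ u f, T ((sphHarm n j).toRepresentation u f) = sphRep n u (T f) := by
    intro u f
    rw [hT, hT, hφ, map_add, map_smul]
    rfl
  have hTinj : ∀ f, T f = 0 → f = 0 := by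
    intro f hf
    rw [hT, add_eq_zero_iff_eq_neg] at hf
    refine Subtype.ext (hdisj _ f.2 ?_)
    rw [hf]
    exact Submodule.neg_mem _ (Submodule.smul_mem _ _ (φ f).2)
  obtain ⟨_, ⟨f, rfl⟩, hf, hf0⟩ := exists_zonal (LinearMap.range T)
    (by
      rintro u _ ⟨f, rfl⟩
      exact ⟨_, hTrep u f⟩)
    (by
      intro h
      have : T ⟨ζ, hζ⟩ ∈ LinearMap.range T := ⟨_, rfl⟩
      rw [h, Submodule.mem_bot] at this
      exact hζne (congrArg Subtype.val (hTinj _ this))) e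
  -- Injectivity of the equivariant map T pulls stabilizer invariance back from T f to f.
  have hfz : (f : C(Sph n, ℂ)) ∈ zonal e := by
    intro u hu
    have h1 := hf u hu
    rw [← hTrep, ← sub_eq_zero, ← map_sub] at h1
    exact congrArg Subtype.val (sub_eq_zero.1 (hTinj _ h1))
  obtain ⟨b, hb⟩ := exists_smul_eq_of_zonal hn hz hζ hζne hfz f.2
  have hfb : f = b • ⟨ζ, hζ⟩ := Subtype.ext hb.symm
  apply hf0
  rw [hfb, map_smul, hT, ← ha]
  simp only [ContinuousMap.smul_apply, ContinuousMap.add_apply, smul_eq_mul, c]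
  field_simp
  ring

end SphericalHarmonics

end

theorem mainTheorem9 (n : ℕ) (hn : 2 ≤ n) :
    -- for every `d`, orthogonal (in particular direct) decomposition of `Pol_{≤ d}(Sⁿ⁻¹)`
    (∀ d : ℕ,
      SphericalHarmonics.polSph n d =
        ⨆ k : Fin (d + 1), (SphericalHarmonics.sphHarm n k).toSubmodule ∧
      iSupIndep (fun k : Fin (d + 1) => (SphericalHarmonics.sphHarm n k).toSubmodule) ∧
      ∀ j k : Fin (d + 1), j ≠ k →
        ∀ f ∈ (SphericalHarmonics.sphHarm n j).toSubmodule,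
        ∀ g ∈ (SphericalHarmonics.sphHarm n k).toSubmodule,
          SphericalHarmonics.sphInner f g = 0) ∧
    -- the zonal spherical functions in each `H_k`, with any given pole, form a line
    (∀ (k : ℕ) (e : SphericalHarmonics.Sph n),
      Module.finrank ℂ
        ↥(SphericalHarmonics.zonal e ⊓ (SphericalHarmonics.sphHarm n k).toSubmodule) = 1) ∧
    -- each `H_k` is irreducible
    (∀ k : ℕ, Representation.IsIrreducible
      (V := ↥(SphericalHarmonics.sphHarm n k).toSubmodule)
      (SphericalHarmonics.sphHarm n k).toRepresentation) ∧
    -- the `H_k` are pairwise inequivalent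
    (∀ j k : ℕ, j ≠ k →
      IsEmpty ((SphericalHarmonics.sphHarm n j).toRepresentation.Equiv
        (SphericalHarmonics.sphHarm n k).toRepresentation)) := by

  open SphericalHarmonics in
  refine ⟨fun d => ⟨polSph_eq_iSup (by omega) d,
    (iSupIndep_sphHarm hn).comp Fin.val_injective, fun j k hjk f hf g hg =>
      sphInner_eq_zero_of_ne hn (fun h => hjk (Fin.ext h)) hf hg⟩,
    fun k e => finrank_zonal_inf_sphHarm hn e k, isIrreducible_sphHarm hn,
    fun j k hjk => isEmpty_equiv_sphHarm hn hjk⟩
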